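/- Let the legitimate nodes $\Phi_l$ and the eavesdroppers $\Phi_e$ be independent homogeneous Poisson point processes in $\mathbb{R}^2$ with densities $\lambda_l \ge 0$ and $\lambda_e \ge 0$. Time is slotted, and the legitimate nodes use slotted ALOHA with parameter $p \in [0,1]$: in every slot each node transmits with probability $p$, all these decisions being independent of each other and of the positions of all nodes and eavesdroppers. In a fixed slot let $\Phi_t \subseteq \Phi_l$ be the set of transmitting nodes and $\Phi_r = \Phi_l \setminus \Phi_t$ the set of receiving nodes (half-duplex operation). Let $\eta, \beta_l, \beta_e > 0$. A transmitter $x$ can securely connect to a receiver $y$ if (C1) $\|x-y\| < \eta$; (C2) the disk $\mathbb{B}(y, \beta_l\|x-y\|)$ contains no transmitter other than $x$; (C3) the disk $\mathbb{B}(x, \beta_e\|x-y\|)$ contains no eavesdropper. Consider the typical transmitter, i.e. an additional transmitter located at the origin, and let $N_{t,0}$ be its secure out-degree, i.e. the number of $y \in \Phi_r$ to which it can securely connect, the set of transmitters being $\Phi_t \cup \{0\}$. If $\lambda_l p \beta_l^2 + \lambda_e\beta_e^2 \neq 0$, then $$\mathbb{E} N_{t,0} = \frac{\lambda_l(1-p)\left[1-\exp\left(-(\lambda_l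 p \beta_l^2 + \lambda_e \beta_e^2)\pi\eta^2\right)\right]}{\lambda_l p \beta_l^2 + \lambda_e \beta_e^2}.$$ -/

import Mathlib

open MeasureTheory ProbabilityTheory
open scoped NNReal ENNReal

namespace SecureGraph

/-- The Euclidean plane. -/
abbrev Plane : Type := EuclideanSpace ℝ (Fin 2)

/-- Number of points of the random set `Φ` in `B`. -/
noncomputable def count {Ω : Type*} (Φ : Ω → Set Plane) (B : Set Plane) (ω : Ω) : ℕ∞ :=
  (Φ ω ∩ B).encard

/-- The σ-algebra on `Ω` generated by a random point set, that is, by its counts on Borel sets. -/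
@[reducible] noncomputable def sigmaPoints {Ω : Type*} (Φ : Ω → Set Plane) : MeasurableSpace Ω :=
  ⨆ B : {B : Set Plane // MeasurableSet B}, MeasurableSpace.comap (count Φ B.1) inferInstance

/-- `Φ` is a homogeneous Poisson point process of density `lam` in the plane: a random locally
finite set whose number of points in a Borel set `B` of finite area is Poisson distributed with
mean `lam * area B`, and whose numbers of points in pairwise disjoint Borel sets are independent. -/
structure IsPoissonProcess {Ω : Type*} [MeasurableSpace Ω] (μ : Measure Ω)
    (Φ : Ω → Set Plane) (lam : ℝ≥0) : Prop where
  locallyFinite : ∀ ω, ∀ B : Set Plane, Bornology.IsBounded B → (Φ ω ∩ B).Finite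
  measurable_count : ∀ B : Set Plane, MeasurableSet B → Measurable (count Φ B)
  law_count : ∀ B : Set Plane, MeasurableSet B → volume B ≠ ∞ →
    HasLaw (count Φ B)
      ((poissonMeasure (lam * (volume B).toNNReal)).map (Nat.cast : ℕ → ℕ∞)) μ
  indep_count : ∀ (m : ℕ) (B : Fin m → Set Plane), (∀ i, MeasurableSet (B i)) →
    Pairwise (fun i j => Disjoint (B i) (B j)) → iIndepFun (fun i => count Φ (B i)) μ

/-- The slotted ALOHA protocol with transmission probability `p` run by the nodes `Φl`, in the
presence of eavesdroppers `Φe`. The nodes are listed measurably and without repetition as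
`node i ω`, `i < num ω`; in slot `k` the `i`-th node transmits if and only if `tx k i ω = true`.
All the decisions `tx k i` are independent of each other and of the positions of all nodes and
eavesdroppers, and each of them is `true` with probability `p`. -/
structure SlottedAloha {Ω : Type*} [MeasurableSpace Ω] (μ : Measure Ω)
    (Φl Φe : Ω → Set Plane) (p : ℝ) where
  num : Ω → ℕ∞
  node : ℕ → Ω → Plane
  tx : ℕ → ℕ → Ω → Bool
  measurable_num : Measurable num
  measurable_node : ∀ i, Measurable (node i)
  measurable_tx : ∀ k i, Measurable (tx k i)
  node_injective : ∀ (ω : Ω) (i j : ℕ), (i : ℕ∞) < num ω → (j : ℕ∞) < num ω →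
    node i ω = node j ω → i = j
  nodes_eq : ∀ ω, Φl ω = {x | ∃ i : ℕ, (i : ℕ∞) < num ω ∧ node i ω = x}
  prob_tx : ∀ k i, μ {ω | tx k i ω = true} = ENNReal.ofReal p
  indep_tx : iIndepFun (fun q : ℕ × ℕ => tx q.1 q.2) μ
  indep_positions :
    Indep (⨆ q : ℕ × ℕ, MeasurableSpace.comap (tx q.1 q.2) inferInstance)
      (MeasurableSpace.comap num inferInstance ⊔
        (⨆ i : ℕ, MeasurableSpace.comap (node i) inferInstance) ⊔ sigmaPoints Φe) μ

/-- The set `Φ_t(k)` of nodes that transmit in slot `k`. -/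
def SlottedAloha.transmitters {Ω : Type*} [MeasurableSpace Ω] {μ : Measure Ω}
    {Φl Φe : Ω → Set Plane} {p : ℝ} (A : SlottedAloha μ Φl Φe p) (k : ℕ) (ω : Ω) : Set Plane :=
  {x | ∃ i : ℕ, (i : ℕ∞) < A.num ω ∧ A.tx k i ω = true ∧ A.node i ω = x}

/-- The set `Φ_r(k)` of receiving nodes in slot `k`: by half-duplex operation, these are the nodes
that do not transmit. -/
def SlottedAloha.receivers {Ω : Type*} [MeasurableSpace Ω] {μ : Measure Ω}
    {Φl Φe : Ω → Set Plane} {p : ℝ} (A : SlottedAloha μ Φl Φe p) (k : ℕ) (ω : Ω) : Set Plane :=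
  Φl ω \ A.transmitters k ω

/-- With transmitters `T` and eavesdroppers `D`, the transmitter `x` can securely connect to the
receiver `y`: the range, the interference and the secrecy constraint. The interference
constraint is on the transmitters other than `x` itself. -/
structure SecurelyConnects (T D : Set Plane) (η βl βe : ℝ) (x y : Plane) : Prop where
  range : ‖x - y‖ < η
  interference : ∀ z ∈ T, z ≠ x → z ∉ Metric.closedBall y (βl * ‖x - y‖)
  secrecy : ∀ z ∈ D, z ∉ Metric.closedBall x (βe * ‖x - y‖)

/-- Secure out-degree of the transmitter `x`: the number of receivers in `R` to which it can
securely connect. -/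
noncomputable def secureOutDegree (T R D : Set Plane) (η βl βe : ℝ) (x : Plane) : ℕ∞ :=
  {y | y ∈ R ∧ SecurelyConnects T D η βl βe x y}.encard

/-- Secure out-degree, in slot `k`, of a transmitter located at the origin, which is added to the
legitimate nodes of the network. -/
noncomputable def outDegreeAtOrigin {Ω : Type*} [MeasurableSpace Ω] {μ : Measure Ω}
    {Φl Φe : Ω → Set Plane} {p : ℝ} (A : SlottedAloha μ Φl Φe p) (η βl βe : ℝ) (k : ℕ)
    (ω : Ω) : ℕ∞ :=
  secureOutDegree (insert 0 (A.transmitters k ω)) (A.receivers k ω) (Φe ω) η βl βe 0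

end SecureGraph

namespace SecureGraph

/-! Put `q = 1 - p`. A node at `y` lies in its own interference disk `D y`, so "`y` is silent and
nobody interferes" means that every node in `D y` is silent, up to the null event that a node sits
at the origin. Given all positions this has probability `q ^ #(Φl ∩ D y)`
(`measure_inter_forall_mem_eq_false`, `measure_connected`). Hence the mean out-degree is the
expectation of the sum of `q ^ #(Φl ∩ D y)` over the nodes `y` in the disk of radius `η` whose
secrecy disk `K y` contains no eavesdropper.

In place of the Mecke formula, this sum is evaluated on a square grid. Within a cell `C` the disks
`D y`, `K y` are replaced by common larger disks `D ⊇ C` and `K`. Splitting `D` into `C` and `D \ C`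
gives `E[#C * q ^ #D] = λ |C| q exp(-λ |D| (1 - q))` (`lintegral_count_mul_pow_count_of_subset`),
and independence of the eavesdroppers contributes `exp(-λe |K|)`. Summing over cells gives the
integral of a step function. As the mesh shrinks, local finiteness makes each node's term eventually
exact (`tendsto_approxTerm`), and dominated convergence on both sides (`lintegral_limitTerm`) leaves
a Gaussian integral over the disk of radius `η` (`lintegral_ball_exp_neg_mul_norm_sq`). -/

/-! ### Generating functions of the Poisson law. -/

theorem lintegral_poissonMeasure (r : ℝ≥0) (f : ℕ → ℝ≥0∞) :
    ∫⁻ n, f n ∂poissonMeasure r =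
      ∑' n, ENNReal.ofReal (Real.exp (-r) * r ^ n / n.factorial) * f n := by
  rw [lintegral_countable']
  exact tsum_congr fun n => by rw [poissonMeasure_singleton, mul_comm]

theorem hasSum_poisson_mul_pow (r q : ℝ) :
    HasSum (fun n : ℕ => Real.exp (-r) * r ^ n / n.factorial * q ^ n)
      (Real.exp (-(r * (1 - q)))) := by
  have h := (NormedSpace.expSeries_div_hasSum_exp (r * q)).mul_left (Real.exp (-r))
  rw [← Real.exp_eq_exp_ℝ, ← Real.exp_add] at h
  rw [show -(r * (1 - q)) = -r + r * q by ring]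
  refine h.congr_fun fun n => ?_
  rw [mul_pow]
  ring

theorem hasSum_poisson_mul_nat_mul_pow (r q : ℝ) :
    HasSum (fun n : ℕ => Real.exp (-r) * r ^ n / n.factorial * (n * q ^ n))
      (r * q * Real.exp (-(r * (1 - q)))) := by
  -- The term at `n = 0` vanishes; after the shift, the factor `n + 1` cancels against `(n + 1)!`.
  rw [← hasSum_nat_add_iff' 1]
  simp only [Finset.range_one, Finset.sum_singleton, Nat.cast_zero, zero_mul, mul_zero, sub_zero]
  refine ((hasSum_poisson_mul_pow r q).mul_left (r * q)).congr_fun fun n => ?_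
  rw [Nat.factorial_succ]
  push_cast
  field_simp
  ring

theorem lintegral_pow_poissonMeasure (r : ℝ≥0) {q : ℝ} (hq : 0 ≤ q) :
    ∫⁻ n, ENNReal.ofReal q ^ n ∂poissonMeasure r =
      ENNReal.ofReal (Real.exp (-(r * (1 - q)))) := by
  rw [lintegral_poissonMeasure, ← (hasSum_poisson_mul_pow r q).tsum_eq,
    ENNReal.ofReal_tsum_of_nonneg (fun n => by positivity) (hasSum_poisson_mul_pow r q).summable]
  refine tsum_congr fun n => ?_
  rw [ENNReal.ofReal_mul (by positivity), ENNReal.ofReal_pow hq]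

theorem lintegral_nat_mul_pow_poissonMeasure (r : ℝ≥0) {q : ℝ} (hq : 0 ≤ q) :
    ∫⁻ n, (n : ℝ≥0∞) * ENNReal.ofReal q ^ n ∂poissonMeasure r =
      ENNReal.ofReal (r * q * Real.exp (-(r * (1 - q)))) := by
  rw [lintegral_poissonMeasure, ← (hasSum_poisson_mul_nat_mul_pow r q).tsum_eq,
    ENNReal.ofReal_tsum_of_nonneg (fun n => by positivity)
      (hasSum_poisson_mul_nat_mul_pow r q).summable]
  refine tsum_congr fun n => ?_
  rw [ENNReal.ofReal_mul (by positivity), ENNReal.ofReal_mul (by positivity),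
    ENNReal.ofReal_pow hq, ENNReal.ofReal_natCast]

/-! ### Expectations of counts of a Poisson process. -/

section Poisson

variable {Ω : Type*} [MeasurableSpace Ω] {μ : Measure Ω} {Φ : Ω → Set Plane} {lam : ℝ≥0}

theorem IsPoissonProcess.lintegral_count (h : IsPoissonProcess μ Φ lam) {B : Set Plane}
    (hB : MeasurableSet B) (hvol : volume B ≠ ∞) (f : ℕ∞ → ℝ≥0∞) :
    ∫⁻ ω, f (count Φ B ω) ∂μ =
      ∫⁻ n : ℕ, f n ∂poissonMeasure (lam * (volume B).toNNReal) := by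
  rw [(h.law_count B hB hvol).lintegral_comp (Measurable.of_discrete.aemeasurable),
    lintegral_map .of_discrete .of_discrete]

theorem IsPoissonProcess.count_ne_top (h : IsPoissonProcess μ Φ lam) {B : Set Plane}
    (hB : Bornology.IsBounded B) (ω : Ω) : count Φ B ω ≠ ⊤ :=
  Set.encard_ne_top_iff.2 (h.locallyFinite ω B hB)

theorem IsPoissonProcess.lintegral_pow_count (h : IsPoissonProcess μ Φ lam) {B : Set Plane}
    (hB : MeasurableSet B) (hvol : volume B ≠ ∞) {q : ℝ} (hq : 0 ≤ q) :
    ∫⁻ ω, ENNReal.ofReal q ^ (count Φ B ω).toNat ∂μ =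
      ENNReal.ofReal (Real.exp (-(lam * volume.real B * (1 - q)))) := by
  rw [h.lintegral_count hB hvol (fun n => ENNReal.ofReal q ^ n.toNat)]
  exact lintegral_pow_poissonMeasure _ hq

theorem IsPoissonProcess.lintegral_count_mul_pow_count (h : IsPoissonProcess μ Φ lam)
    {B : Set Plane} (hB : MeasurableSet B) (hvol : volume B ≠ ∞) {q : ℝ} (hq : 0 ≤ q) :
    ∫⁻ ω, (count Φ B ω : ℝ≥0∞) * ENNReal.ofReal q ^ (count Φ B ω).toNat ∂μ =
      ENNReal.ofReal (lam * volume.real B * q *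
        Real.exp (-(lam * volume.real B * (1 - q)))) := by
  rw [h.lintegral_count hB hvol (fun n => (n : ℝ≥0∞) * ENNReal.ofReal q ^ n.toNat)]
  exact lintegral_nat_mul_pow_poissonMeasure _ hq

theorem IsPoissonProcess.lintegral_count_eq (h : IsPoissonProcess μ Φ lam)
    {B : Set Plane} (hB : MeasurableSet B) (hvol : volume B ≠ ∞) :
    ∫⁻ ω, (count Φ B ω : ℝ≥0∞) ∂μ = ENNReal.ofReal (lam * volume.real B) := by
  simpa using h.lintegral_count_mul_pow_count hB hvol zero_le_one

theorem count_union {Ω : Type*} {Φ : Ω → Set Plane} {B C : Set Plane} (hBC : Disjoint B C) (ω : Ω) :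
    count Φ (B ∪ C) ω = count Φ B ω + count Φ C ω := by
  rw [count, Set.inter_union_distrib_left, Set.encard_union_eq]
  · rfl
  · exact hBC.mono Set.inter_subset_right Set.inter_subset_right

/-- The counts of `C` and `D \ C` are independent and add up to that of `D`, so the expectation
factors and the two exponentials recombine. This plays the role of the Mecke formula: the isolated
factor `q` belongs to the counted point itself. -/
theorem IsPoissonProcess.lintegral_count_mul_pow_count_of_subset (h : IsPoissonProcess μ Φ lam)
    {C D : Set Plane} (hC : MeasurableSet C) (hD : MeasurableSet D) (hCD : C ⊆ D)
    (hbd : Bornology.IsBounded D) {q : ℝ} (hq : 0 ≤ q) :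
    ∫⁻ ω, (count Φ C ω : ℝ≥0∞) * ENNReal.ofReal q ^ (count Φ D ω).toNat ∂μ =
      ENNReal.ofReal (lam * volume.real C * q * Real.exp (-(lam * volume.real D * (1 - q)))) := by
  have hdisj : Disjoint C (D \ C) := Set.disjoint_sdiff_right
  have hDfin : volume D ≠ ∞ := hbd.measure_lt_top.ne
  have hCfin : volume C ≠ ∞ := (hbd.subset hCD).measure_lt_top.ne
  have hDCfin : volume (D \ C) ≠ ∞ := (hbd.subset Set.sdiff_subset).measure_lt_top.ne
  -- `ENat.toNat` sends `⊤` to `0`, so additivity needs both counts finite; boundedness of `D`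
  -- provides this.
  have hcount : ∀ ω, (count Φ D ω).toNat = (count Φ C ω).toNat + (count Φ (D \ C) ω).toNat := by
    intro ω
    rw [← ENat.toNat_add (h.count_ne_top (hbd.subset hCD) ω)
      (h.count_ne_top (hbd.subset Set.sdiff_subset) ω), ← count_union hdisj,
      Set.union_sdiff_cancel hCD]
  have hind : IndepFun (count Φ C) (count Φ (D \ C)) μ := by
    have := h.indep_count 2 ![C, D \ C]
      (by intro i; fin_cases i; exacts [hC, hD.diff hC])
      (by
        intro i j hij
        fin_cases i <;> fin_cases j <;> simp at hij ⊢
        · exact hdisj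
        · exact hdisj.symm)
    exact this.indepFun (i := 0) (j := 1) (by decide)
  have hmC := h.measurable_count C hC
  have hmDC := h.measurable_count (D \ C) (hD.diff hC)
  let f : ℕ∞ → ℝ≥0∞ := fun n => (n : ℝ≥0∞) * ENNReal.ofReal q ^ n.toNat
  let g : ℕ∞ → ℝ≥0∞ := fun n => ENNReal.ofReal q ^ n.toNat
  have hf : Measurable f := .of_discrete
  have hg : Measurable g := .of_discrete
  calc ∫⁻ ω, (count Φ C ω : ℝ≥0∞) * ENNReal.ofReal q ^ (count Φ D ω).toNat ∂μ
      = ∫⁻ ω, ((f ∘ count Φ C) * (g ∘ count Φ (D \ C))) ω ∂μ := by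
        refine lintegral_congr fun ω => ?_
        simp only [f, g, Pi.mul_apply, Function.comp_apply, hcount, pow_add, mul_assoc]
    _ = (∫⁻ ω, f (count Φ C ω) ∂μ) * ∫⁻ ω, g (count Φ (D \ C) ω) ∂μ :=
        lintegral_mul_eq_lintegral_mul_lintegral_of_indepFun (hf.comp hmC) (hg.comp hmDC)
          (hind.comp hf hg)
    _ = _ := by
        rw [h.lintegral_count_mul_pow_count hC hCfin hq,
          h.lintegral_pow_count (hD.diff hC) hDCfin hq, ← ENNReal.ofReal_mul (by positivity),
          mul_assoc, ← Real.exp_add, measureReal_sdiff hCD hC hDfin]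
        congr 3
        ring

theorem measurable_count_sigmaPoints {Ω : Type*} {Φ : Ω → Set Plane} {B : Set Plane} (hB : MeasurableSet B) :
    Measurable[sigmaPoints Φ] (count Φ B) :=
  Measurable.mono (comap_measurable _)
    (le_iSup (fun B : {B : Set Plane // MeasurableSet B} =>
      MeasurableSpace.comap (count Φ B.1) inferInstance) ⟨B, hB⟩) le_rfl

theorem IsPoissonProcess.sigmaPoints_le (h : IsPoissonProcess μ Φ lam) :
    sigmaPoints Φ ≤ ‹MeasurableSpace Ω› :=
  iSup_le fun B => (h.measurable_count B.1 B.2).comap_le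

theorem IsPoissonProcess.measure_count_eq_zero (h : IsPoissonProcess μ Φ lam) {B : Set Plane}
    (hB : MeasurableSet B) (hvol : volume B ≠ ∞) :
    μ {ω | count Φ B ω = 0} = ENNReal.ofReal (Real.exp (-(lam * volume.real B))) := by
  have := (h.law_count B hB hvol).measure_eq (p := fun n => n = 0) (.of_discrete)
  rw [this, Measure.map_apply .of_discrete .of_discrete]
  have h0 : (Nat.cast : ℕ → ℕ∞) ⁻¹' {x | x = 0} = {0} := by ext; simp
  rw [h0, poissonMeasure_singleton]
  simp [Measure.real, ENNReal.toReal]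

end Poisson

/-- The integral of a Gaussian over a disk. -/
theorem lintegral_ball_exp_neg_mul_norm_sq {c η : ℝ} (hc : c ≠ 0) (hη : 0 < η) :
    ∫⁻ y in Metric.ball (0 : Plane) η, ENNReal.ofReal (Real.exp (-(c * Real.pi * ‖y‖ ^ 2))) =
      ENNReal.ofReal ((1 - Real.exp (-(c * Real.pi * η ^ 2))) / c) := by
  have hcont : Continuous fun y : Plane => Real.exp (-(c * Real.pi * ‖y‖ ^ 2)) := by fun_prop
  have hint : IntegrableOn (fun y : Plane => Real.exp (-(c * Real.pi * ‖y‖ ^ 2)))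
      (Metric.ball 0 η) :=
    (hcont.continuousOn.integrableOn_compact (isCompact_closedBall (0 : Plane) η)).mono_set
      Metric.ball_subset_closedBall
  rw [← ofReal_integral_eq_lintegral_ofReal hint (ae_of_all _ fun _ => (Real.exp_pos _).le)]
  congr 1
  -- The cutoff at `η` is absorbed into the radial profile, since the polar-coordinate formula
  -- integrates a function of the norm over the whole plane.
  let f : ℝ → ℝ := (Set.Iio η).indicator fun r => Real.exp (-(c * Real.pi * r ^ 2))
  have hf : ∀ y : Plane, (Metric.ball (0 : Plane) η).indicator
      (fun y : Plane => Real.exp (-(c * Real.pi * ‖y‖ ^ 2))) y = f ‖y‖ := by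
    intro y
    by_cases hy : ‖y‖ < η
    · rw [Set.indicator_of_mem (show y ∈ Metric.ball (0 : Plane) η by simpa using hy)]
      simp only [f]
      rw [Set.indicator_of_mem (show ‖y‖ ∈ Set.Iio η from hy)]
    · rw [Set.indicator_of_notMem (show y ∉ Metric.ball (0 : Plane) η by simpa using hy)]
      simp only [f]
      rw [Set.indicator_of_notMem (show ‖y‖ ∉ Set.Iio η from hy)]
  rw [← integral_indicator measurableSet_ball, integral_congr_ae (ae_of_all _ hf),
    integral_fun_norm_addHaar volume f]
  have hball : volume.real (Metric.ball (0 : Plane) 1) = Real.pi := by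
    simp [Measure.real, EuclideanSpace.volume_ball_fin_two, Real.pi_pos.le]
  have hg : ∀ r : ℝ, r ^ (Module.finrank ℝ Plane - 1) • f r =
      (Set.Iio η).indicator (fun r => r * Real.exp (-(c * Real.pi * r ^ 2))) r := by
    intro r
    simp [f, Set.indicator_apply]
  have hderiv : ∀ r ∈ Set.uIcc 0 η,
      HasDerivAt (fun r : ℝ => -Real.exp (-(c * Real.pi * r ^ 2)) / (2 * (c * Real.pi)))
        (r * Real.exp (-(c * Real.pi * r ^ 2))) r := by
    intro r _
    have h := (((((hasDerivAt_id r).pow 2).const_mul (c * Real.pi)).neg.exp).neg).div_const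
      (2 * (c * Real.pi))
    refine h.congr_deriv ?_
    have := Real.pi_ne_zero
    simp only [Pi.neg_apply, Pi.pow_apply, id_eq, Nat.cast_ofNat]
    field_simp
    norm_num
  rw [hball]
  simp_rw [hg]
  rw [integral_indicator measurableSet_Iio, Measure.restrict_restrict measurableSet_Iio,
    Set.inter_comm, Set.Ioi_inter_Iio, ← integral_Ioc_eq_integral_Ioo,
    ← intervalIntegral.integral_of_le hη.le,
    intervalIntegral.integral_eq_sub_of_hasDerivAt hderiv
      (Continuous.intervalIntegrable (by fun_prop) _ _)]
  have := Real.pi_ne_zero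
  simp
  field_simp
  ring

/-! ### Cardinalities as sums, and independent thinning. -/

theorem encard_eq_tsum_indicator {α : Type*} (S : Set α) :
    (S.encard : ℝ≥0∞) = ∑' i, S.indicator 1 i := by
  rw [← ENNReal.tsum_set_one, ← tsum_subtype]
  rfl

/-- Independent thinning: if the marks `tx j` are independent of each other and of `m`, and each of
them is `false` with probability `q`, then conditionally on `m` all the marks in a random finite
set `S` are `false` with probability `q ^ #S`. -/
theorem measure_inter_forall_mem_eq_false {Ω : Type*} {m m0 : MeasurableSpace Ω} {μ : Measure Ω}
    (hm : m ≤ m0) {tx : ℕ → Ω → Bool} (htx : ∀ j, Measurable (tx j)) (hind : iIndepFun tx μ)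
    (hindep : Indep (⨆ j, MeasurableSpace.comap (tx j) inferInstance) m μ)
    {q : ℝ≥0∞} (hq : ∀ j, μ {ω | tx j ω = false} = q)
    {S : Ω → Set ℕ} (hSfin : ∀ ω, (S ω).Finite) (hS : ∀ j, MeasurableSet[m] {ω | j ∈ S ω})
    {E : Set Ω} (hE : MeasurableSet[m] E) :
    μ (E ∩ {ω | ∀ j ∈ S ω, tx j ω = false}) = ∫⁻ ω in E, q ^ (S ω).ncard ∂μ := by
  -- `S` takes only countably many values, all finite sets. On `P s`, which belongs to `m`, the
  -- event reduces to `Q s`, which depends on the marks alone.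
  let P : Finset ℕ → Set Ω := fun s => E ∩ {ω | S ω = s}
  let Q : Finset ℕ → Set Ω := fun s => ⋂ j ∈ s, tx j ⁻¹' {false}
  have hPm : ∀ s, MeasurableSet[m] (P s) := by
    intro s
    refine MeasurableSet.inter hE ?_
    have : {ω | S ω = s} = ⋂ j, {ω | j ∈ S ω ↔ j ∈ s} := by
      ext ω; simp [Set.ext_iff]
    rw [this]
    refine MeasurableSet.iInter fun j => ?_
    by_cases hj : j ∈ s
    · simpa [hj] using hS j
    · have hc : {ω | j ∈ S ω ↔ j ∈ s} = {ω | j ∈ S ω}ᶜ := by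
        ext ω; simp [hj]
      rw [hc]
      exact (hS j).compl
  have hQm : ∀ s, MeasurableSet[⨆ j, MeasurableSpace.comap (tx j) inferInstance] (Q s) := by
    intro s
    refine MeasurableSet.biInter s.countable_toSet fun j _ => ?_
    exact le_iSup (fun j => MeasurableSpace.comap (tx j) inferInstance) j _
      ⟨{false}, measurableSet_singleton _, rfl⟩
  have hQle : (⨆ j, MeasurableSpace.comap (tx j) inferInstance) ≤ m0 :=
    iSup_le fun j => (htx j).comap_le
  have hdisj : Pairwise (Function.onFun Disjoint P) := by
    intro s t hst
    refine Set.disjoint_left.2 fun ω hs ht => hst ?_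
    exact Finset.coe_injective (hs.2.symm.trans ht.2)
  have hEU : E = ⋃ s, P s := by
    ext ω
    simp only [P, Set.mem_iUnion, Set.mem_inter_iff, Set.mem_ofPred_eq, exists_and_left]
    exact ⟨fun h => ⟨h, (hSfin ω).toFinset, by simp⟩, fun h => h.1⟩
  have hU : E ∩ {ω | ∀ j ∈ S ω, tx j ω = false} = ⋃ s, P s ∩ Q s := by
    ext ω
    simp only [P, Q, Set.mem_iUnion, Set.mem_inter_iff, Set.mem_ofPred_eq, Set.mem_iInter,
      Set.mem_preimage, Set.mem_singleton_iff]
    constructor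
    · rintro ⟨h1, h2⟩
      exact ⟨(hSfin ω).toFinset, ⟨h1, by simp⟩, fun j hj => h2 j (by simpa using hj)⟩
    · rintro ⟨s, ⟨h1, h2⟩, h3⟩
      exact ⟨h1, fun j hj => h3 j (by rw [h2] at hj; exact hj)⟩
  have hQ : ∀ s, μ (Q s) = q ^ s.card := by
    intro s
    rw [hind.measure_inter_preimage_eq_mul s (sets := fun _ => {false})
      fun j _ => measurableSet_singleton _]
    exact (Finset.prod_congr rfl fun j _ => hq j).trans (Finset.prod_const q)
  rw [hU, measure_iUnion
    (fun s t hst => (hdisj hst).mono Set.inter_subset_left Set.inter_subset_left)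
    (fun s => (hm _ (hPm s)).inter (hQle _ (hQm s)))]
  conv_rhs => rw [hEU]
  rw [lintegral_iUnion (fun s => hm _ (hPm s)) hdisj]
  refine tsum_congr fun s => ?_
  have hc : ∀ ω ∈ P s, q ^ (S ω).ncard = q ^ s.card := by
    intro ω hω
    rw [show S ω = s from hω.2, Set.ncard_coe_finset]
  rw [setLIntegral_congr_fun (hm _ (hPm s)) hc, setLIntegral_const, Set.inter_comm,
    (Indep_iff _ _ μ).1 hindep _ _ (hQm s) (hPm s), hQ]

/-! ### Locally finite sets and closed disks. -/

section LocallyFinite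

variable {Ω : Type*} {Φ : Ω → Set Plane}

/-- Closed disks are stable under small enlargements, as far as a locally finite set is
concerned. -/
theorem exists_count_eq_count_closedBall {ω : Ω}
    (hΦ : ∀ B : Set Plane, Bornology.IsBounded B → (Φ ω ∩ B).Finite) (y : Plane) (r : ℝ) :
    ∃ δ > 0, ∀ s : Set Plane, Metric.closedBall y r ⊆ s → s ⊆ Metric.closedBall y (r + δ) →
      count Φ s ω = count Φ (Metric.closedBall y r) ω := by
  -- Finitely many points lie in the annulus, each strictly farther than `r`, so `δ` can be taken
  -- below all the gaps. The width `1` is arbitrary.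
  have hfin : ((Φ ω ∩ Metric.closedBall y (r + 1)) \ Metric.closedBall y r).Finite :=
    (hΦ _ Metric.isBounded_closedBall).sdiff
  have hev : ∀ᶠ δ in nhdsWithin (0 : ℝ) (Set.Ioi 0),
      ∀ z ∈ (Φ ω ∩ Metric.closedBall y (r + 1)) \ Metric.closedBall y r, r + δ < dist z y := by
    refine (Filter.eventually_all_finite hfin).2 fun z hz => ?_
    have hz' : 0 < dist z y - r := by
      have := hz.2
      rw [Metric.mem_closedBall, not_le] at this
      linarith
    filter_upwards [Ioo_mem_nhdsGT hz'] with δ hδ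
    linarith [hδ.2]
  obtain ⟨δ, hδ, hδ1⟩ := (hev.and (Ioo_mem_nhdsGT (one_pos (α := ℝ)))).exists
  refine ⟨δ, hδ1.1, fun s h1 h2 => ?_⟩
  unfold count
  congr 1
  refine Set.Subset.antisymm (fun z hz => ⟨hz.1, ?_⟩) (Set.inter_subset_inter_right _ h1)
  by_contra hzr
  have hzs := h2 hz.2
  have := hδ z ⟨⟨hz.1, Metric.closedBall_subset_closedBall (by linarith [hδ1.2]) hzs⟩, hzr⟩
  exact absurd (Metric.mem_closedBall.1 hzs) (not_le.2 this)

theorem eventually_count_eq_count_closedBall {ω : Ω}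
    (hΦ : ∀ B : Set Plane, Bornology.IsBounded B → (Φ ω ∩ B).Finite) {y : Plane} {r : ℝ}
    {s : ℕ → Set Plane} {ε : ℕ → ℝ} (hε : Filter.Tendsto ε Filter.atTop (nhds 0))
    (h1 : ∀ n, Metric.closedBall y r ⊆ s n) (h2 : ∀ n, s n ⊆ Metric.closedBall y (r + ε n)) :
    ∀ᶠ n in Filter.atTop, count Φ (s n) ω = count Φ (Metric.closedBall y r) ω := by
  obtain ⟨δ, hδ, h⟩ := exists_count_eq_count_closedBall hΦ y r
  filter_upwards [hε.eventually_lt_const hδ] with n hn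
  exact h _ (h1 n) ((h2 n).trans (Metric.closedBall_subset_closedBall (by linarith)))

/-- An empty closed disk stays empty up to some slightly larger rational radius, so the random
radius is traded for a countable union over deterministic ones. -/
theorem measurableSet_count_closedBall_eq_zero {m : MeasurableSpace Ω}
    (hΦ : ∀ ω, ∀ B : Set Plane, Bornology.IsBounded B → (Φ ω ∩ B).Finite)
    (hcount : ∀ B : Set Plane, MeasurableSet B → Measurable (count Φ B))
    (x : Plane) {R : Ω → ℝ} (hR : Measurable R) :
    MeasurableSet {ω | count Φ (Metric.closedBall x (R ω)) ω = 0} := by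
  have : {ω | count Φ (Metric.closedBall x (R ω)) ω = 0} =
      ⋃ r : ℚ, {ω | R ω < r} ∩ {ω | count Φ (Metric.closedBall x r) ω = 0} := by
    ext ω
    simp only [Set.mem_ofPred_eq, Set.mem_iUnion, Set.mem_inter_iff]
    constructor
    · intro h
      obtain ⟨δ, hδ, hs⟩ := exists_count_eq_count_closedBall (hΦ ω) x (R ω)
      obtain ⟨r, hr1, hr2⟩ := exists_rat_btwn (show R ω < R ω + δ by linarith)
      refine ⟨r, hr1, ?_⟩
      rw [hs _ (Metric.closedBall_subset_closedBall hr1.le)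
        (Metric.closedBall_subset_closedBall hr2.le), h]
    · rintro ⟨r, hr1, hr2⟩
      rw [count, Set.encard_eq_zero] at hr2 ⊢
      exact Set.subset_empty_iff.1 (hr2 ▸ Set.inter_subset_inter_right _
        (Metric.closedBall_subset_closedBall hr1.le))
  rw [this]
  refine MeasurableSet.iUnion fun r => (measurableSet_lt hR measurable_const).inter ?_
  exact hcount _ Metric.isClosed_closedBall.measurableSet (measurableSet_singleton 0)

end LocallyFinite

/-! ### Conditioning the ALOHA decisions on the positions. -/

section Aloha

variable {Ω : Type*} [MeasurableSpace Ω] {μ : Measure Ω} {Φl Φe : Ω → Set Plane} {p : ℝ}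

namespace SlottedAloha

variable (A : SlottedAloha μ Φl Φe p)

/-- The set of indices of nodes in `B`. -/
def indices (B : Set Plane) (ω : Ω) : Set ℕ := {j | (j : ℕ∞) < A.num ω ∧ A.node j ω ∈ B}

theorem image_indices (B : Set Plane) (ω : Ω) :
    (fun j => A.node j ω) '' A.indices B ω = Φl ω ∩ B := by
  ext x
  rw [A.nodes_eq ω]
  constructor
  · rintro ⟨j, ⟨h1, h2⟩, rfl⟩
    exact ⟨⟨j, h1, rfl⟩, h2⟩
  · rintro ⟨⟨j, h1, rfl⟩, h2⟩
    exact ⟨j, ⟨h1, h2⟩, rfl⟩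

theorem injOn_node_indices (B : Set Plane) (ω : Ω) :
    Set.InjOn (fun j => A.node j ω) (A.indices B ω) :=
  fun i hi j hj h => A.node_injective ω i j hi.1 hj.1 h

theorem encard_indices (B : Set Plane) (ω : Ω) : (A.indices B ω).encard = count Φl B ω := by
  rw [count, ← A.image_indices B ω, (A.injOn_node_indices B ω).encard_image]

theorem count_eq_tsum (B : Set Plane) (ω : Ω) :
    (count Φl B ω : ℝ≥0∞) = ∑' i, (A.indices B ω).indicator 1 i := by
  rw [← A.encard_indices, encard_eq_tsum_indicator]

/-- The σ-algebra generated by the positions of the nodes and of the eavesdroppers. -/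
@[reducible] noncomputable def sigmaPositions {Ω : Type*} [MeasurableSpace Ω] {μ : Measure Ω}
    {Φl Φe : Ω → Set Plane} {p : ℝ} (A : SlottedAloha μ Φl Φe p) : MeasurableSpace Ω :=
  MeasurableSpace.comap A.num inferInstance ⊔
    (⨆ i : ℕ, MeasurableSpace.comap (A.node i) inferInstance) ⊔ sigmaPoints Φe

theorem measurable_num_sigmaPositions : Measurable[A.sigmaPositions] A.num :=
  (comap_measurable _).mono (le_sup_left.trans le_sup_left) le_rfl

theorem measurable_node_sigmaPositions (i : ℕ) : Measurable[A.sigmaPositions] (A.node i) :=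
  (comap_measurable _).mono (((le_iSup (fun i : ℕ =>
    MeasurableSpace.comap (A.node i) inferInstance) i).trans le_sup_right).trans le_sup_left) le_rfl

theorem measurable_count_sigmaPositions {B : Set Plane} (hB : MeasurableSet B) :
    Measurable[A.sigmaPositions] (count Φe B) :=
  (measurable_count_sigmaPoints hB).mono le_sup_right le_rfl

theorem sigmaPositions_le {lamE : ℝ≥0} (hΦe : IsPoissonProcess μ Φe lamE) :
    A.sigmaPositions ≤ ‹MeasurableSpace Ω› :=
  sup_le (sup_le A.measurable_num.comap_le (iSup_le fun i => (A.measurable_node i).comap_le))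
    hΦe.sigmaPoints_le

/-- The event that the `i`-th node exists and satisfies the range and the secrecy constraint with
respect to a transmitter at the origin. -/
def reachable (η βe : ℝ) (i : ℕ) : Set Ω :=
  {ω | (i : ℕ∞) < A.num ω ∧ ‖A.node i ω‖ < η ∧
    count Φe (Metric.closedBall 0 (βe * ‖A.node i ω‖)) ω = 0}

/-- The interference disk of the `i`-th node, for a transmitter at the origin. -/
def interferenceDisk (βl : ℝ) (i : ℕ) (ω : Ω) : Set Plane :=
  Metric.closedBall (A.node i ω) (βl * ‖A.node i ω‖)

theorem measurableSet_reachable {lamE : ℝ≥0} (hΦe : IsPoissonProcess μ Φe lamE) (η βe : ℝ)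
    (i : ℕ) : MeasurableSet[A.sigmaPositions] (A.reachable η βe i) := by
  have hnode := A.measurable_node_sigmaPositions i
  have h1 : MeasurableSet[A.sigmaPositions] {ω | (i : ℕ∞) < A.num ω} :=
    A.measurable_num_sigmaPositions (t := {n | (i : ℕ∞) < n}) .of_discrete
  have h2 : MeasurableSet[A.sigmaPositions] {ω | ‖A.node i ω‖ < η} :=
    hnode (t := {y | ‖y‖ < η}) (measurableSet_lt measurable_norm measurable_const)
  have h3 := measurableSet_count_closedBall_eq_zero (m := A.sigmaPositions) hΦe.locallyFinite
    (fun B hB => A.measurable_count_sigmaPositions hB) 0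
    (R := fun ω => βe * ‖A.node i ω‖) ((measurable_norm.comp hnode).const_mul βe)
  exact h1.inter (h2.inter h3)

theorem measurableSet_mem_indices_interferenceDisk (βl : ℝ) (i j : ℕ) :
    MeasurableSet[A.sigmaPositions] {ω | j ∈ A.indices (A.interferenceDisk βl i ω) ω} := by
  have h1 : MeasurableSet[A.sigmaPositions] {ω | (j : ℕ∞) < A.num ω} :=
    A.measurable_num_sigmaPositions (t := {n | (j : ℕ∞) < n}) .of_discrete
  have h2 : MeasurableSet[A.sigmaPositions]
      {ω | dist (A.node j ω) (A.node i ω) ≤ βl * ‖A.node i ω‖} :=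
    ((A.measurable_node_sigmaPositions j).prodMk (A.measurable_node_sigmaPositions i))
      (t := {y : Plane × Plane | dist y.1 y.2 ≤ βl * ‖y.2‖})
      (isClosed_le (by fun_prop) (by fun_prop)).measurableSet
  exact h1.inter h2

/-- The event that a transmitter at the origin can securely connect to the `i`-th node. -/
def connected (η βl βe : ℝ) (k i : ℕ) : Set Ω :=
  A.reachable η βe i ∩ {ω | A.tx k i ω = false ∧ ∀ j ∈ A.indices (A.interferenceDisk βl i ω) ω,
    A.tx k j ω = true → A.node j ω = 0}

theorem measurableSet_connected {lamE : ℝ≥0} (hΦe : IsPoissonProcess μ Φe lamE) (η βl βe : ℝ)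
    (k i : ℕ) : MeasurableSet (A.connected η βl βe k i) := by
  refine (A.sigmaPositions_le hΦe _ (A.measurableSet_reachable hΦe η βe i)).inter ?_
  have hset : {ω | ∀ j ∈ A.indices (A.interferenceDisk βl i ω) ω,
      A.tx k j ω = true → A.node j ω = 0} =
      ⋂ j, ({ω | j ∈ A.indices (A.interferenceDisk βl i ω) ω} ∩ A.tx k j ⁻¹' {true} ∩
        (A.node j ⁻¹' {0})ᶜ)ᶜ := by
    ext ω
    simp only [Set.mem_ofPred_eq, Set.mem_iInter, Set.mem_compl_iff, Set.mem_inter_iff,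
      Set.mem_preimage, Set.mem_singleton_iff]
    exact forall_congr' fun j => by tauto
  suffices h : MeasurableSet {ω | ∀ j ∈ A.indices (A.interferenceDisk βl i ω) ω,
      A.tx k j ω = true → A.node j ω = 0} from
    (A.measurable_tx k i (measurableSet_singleton false)).inter h
  rw [hset]
  refine MeasurableSet.iInter fun j => (MeasurableSet.inter (MeasurableSet.inter ?_ ?_) ?_).compl
  · exact A.sigmaPositions_le hΦe _ (A.measurableSet_mem_indices_interferenceDisk βl i j)
  · exact A.measurable_tx k j (measurableSet_singleton true)
  · exact (A.measurable_node j (measurableSet_singleton 0)).compl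

/-- Since the listing has no repetitions, the position of a silent node cannot also be that of a
transmitting one. -/
theorem mem_receivers_iff (k : ℕ) (ω : Ω) (y : Plane) :
    y ∈ A.receivers k ω ↔ ∃ i : ℕ, (i : ℕ∞) < A.num ω ∧ A.tx k i ω = false ∧ A.node i ω = y := by
  unfold receivers transmitters
  rw [A.nodes_eq ω]
  constructor
  · rintro ⟨⟨i, hi, rfl⟩, h⟩
    refine ⟨i, hi, ?_, rfl⟩
    by_contra hc
    exact h ⟨i, hi, by simpa using hc, rfl⟩
  · rintro ⟨i, hi, htx, rfl⟩
    refine ⟨⟨i, hi, rfl⟩, ?_⟩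
    rintro ⟨j, hj, hjt, hji⟩
    rw [A.node_injective ω j i hj hi hji, htx] at hjt
    exact absurd hjt (by decide)

theorem securelyConnects_node_iff (η βl βe : ℝ) (k i : ℕ) (ω : Ω) :
    SecurelyConnects (insert 0 (A.transmitters k ω)) (Φe ω) η βl βe 0 (A.node i ω) ↔
      ‖A.node i ω‖ < η ∧
      (∀ j ∈ A.indices (A.interferenceDisk βl i ω) ω, A.tx k j ω = true → A.node j ω = 0) ∧
      count Φe (Metric.closedBall 0 (βe * ‖A.node i ω‖)) ω = 0 := by
  rw [count, Set.encard_eq_zero, Set.eq_empty_iff_forall_notMem]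
  constructor
  · rintro ⟨h1, h2, h3⟩
    simp only [zero_sub, norm_neg] at h1 h2 h3
    refine ⟨h1, fun j hj htx => ?_, fun z hz => h3 z hz.1 hz.2⟩
    by_contra h0
    exact h2 _ (Set.mem_insert_of_mem _ ⟨j, hj.1, htx, rfl⟩) h0 hj.2
  · rintro ⟨h1, h2, h3⟩
    refine ⟨?_, ?_, ?_⟩ <;> simp only [zero_sub, norm_neg]
    · exact h1
    · rintro z (rfl | ⟨j, hj, htx, rfl⟩) hz0 hz
      · exact hz0 rfl
      · exact hz0 (h2 j ⟨hj, hz⟩ htx)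
    · exact fun z hz hzb => h3 z ⟨hz, hzb⟩

theorem outDegreeAtOrigin_eq_tsum (η βl βe : ℝ) (k : ℕ) (ω : Ω) :
    (outDegreeAtOrigin A η βl βe k ω : ℝ≥0∞) =
      ∑' i, (A.connected η βl βe k i).indicator 1 ω := by
  have himage : {y | y ∈ A.receivers k ω ∧
      SecurelyConnects (insert 0 (A.transmitters k ω)) (Φe ω) η βl βe 0 y} =
      (fun i => A.node i ω) '' {i | ω ∈ A.connected η βl βe k i} := by
    ext y
    simp only [Set.mem_ofPred_eq, mem_receivers_iff, Set.mem_image]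
    constructor
    · rintro ⟨⟨i, hi, htx, rfl⟩, hs⟩
      obtain ⟨h1, h2, h3⟩ := (A.securelyConnects_node_iff η βl βe k i ω).1 hs
      exact ⟨i, ⟨⟨hi, h1, h3⟩, htx, h2⟩, rfl⟩
    · rintro ⟨i, ⟨⟨hi, h1, h3⟩, htx, h2⟩, rfl⟩
      exact ⟨⟨i, hi, htx, rfl⟩, (A.securelyConnects_node_iff η βl βe k i ω).2 ⟨h1, h2, h3⟩⟩
  have hinj : Set.InjOn (fun i => A.node i ω) {i | ω ∈ A.connected η βl βe k i} :=
    fun i hi j hj h => A.node_injective ω i j hi.1.1 hj.1.1 h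
  rw [outDegreeAtOrigin, secureOutDegree, himage, hinj.encard_image, encard_eq_tsum_indicator]
  rfl

theorem measurable_outDegreeAtOrigin {lamE : ℝ≥0} (hΦe : IsPoissonProcess μ Φe lamE)
    (η βl βe : ℝ) (k : ℕ) : Measurable (outDegreeAtOrigin A η βl βe k) := by
  have h : Measurable fun ω => (outDegreeAtOrigin A η βl βe k ω : ℝ≥0∞) := by
    simp_rw [A.outDegreeAtOrigin_eq_tsum]
    exact Measurable.tsum fun i =>
      measurable_one.indicator (A.measurableSet_connected hΦe η βl βe k i)
  refine ENat.measurable_iff.2 fun n => ?_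
  convert h (measurableSet_singleton (n : ℝ≥0∞)) using 1
  ext ω
  simp only [Set.mem_preimage, Set.mem_singleton_iff]
  rw [← ENat.toENNReal_coe, ENat.toENNReal_inj]

/-- Almost surely, no node is located at the origin. -/
theorem ae_node_ne_zero {lamL : ℝ≥0} (hΦl : IsPoissonProcess μ Φl lamL)
    [IsProbabilityMeasure μ] :
    ∀ᵐ ω ∂μ, ∀ j : ℕ, (j : ℕ∞) < A.num ω → A.node j ω ≠ 0 := by
  have h0 : ∫⁻ ω, (count Φl {0} ω : ℝ≥0∞) ∂μ = 0 := by
    rw [hΦl.lintegral_count_eq (measurableSet_singleton 0) (by simp)]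
    simp [Measure.real]
  have hmeas : Measurable fun ω => (count Φl {0} ω : ℝ≥0∞) :=
    (Measurable.of_discrete (f := ENat.toENNReal)).comp
      (hΦl.measurable_count {0} (measurableSet_singleton 0))
  filter_upwards [(lintegral_eq_zero_iff hmeas).1 h0] with ω hω j hj hj0
  have hc : count Φl {0} ω = 0 := by simpa using hω
  rw [count, Set.encard_eq_zero] at hc
  exact (Set.eq_empty_iff_forall_notMem.1 hc) 0
    ⟨by rw [A.nodes_eq ω]; exact ⟨j, hj, hj0⟩, rfl⟩

theorem measure_tx_eq_false [IsProbabilityMeasure μ] (hp : 0 ≤ p) (k i : ℕ) :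
    μ {ω | A.tx k i ω = false} = ENNReal.ofReal (1 - p) := by
  have hset : {ω | A.tx k i ω = false} = {ω | A.tx k i ω = true}ᶜ := by
    ext ω; simp
  have hm : MeasurableSet {ω | A.tx k i ω = true} :=
    A.measurable_tx k i (measurableSet_singleton true)
  rw [hset, prob_compl_eq_one_sub hm, A.prob_tx, ENNReal.ofReal_sub _ hp, ENNReal.ofReal_one]

/-- Almost surely no node sits at the origin, so the exemption of the transmitter itself plays no
role and thinning applies to all nodes of the interference disk. -/
theorem measure_connected [IsProbabilityMeasure μ] (hp : 0 ≤ p) {lamL lamE : ℝ≥0}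
    (hΦl : IsPoissonProcess μ Φl lamL) (hΦe : IsPoissonProcess μ Φe lamE) (η βe : ℝ) {βl : ℝ}
    (hβl : 0 ≤ βl) (k i : ℕ) :
    μ (A.connected η βl βe k i) = ∫⁻ ω in A.reachable η βe i,
      ENNReal.ofReal (1 - p) ^ (count Φl (A.interferenceDisk βl i ω) ω).toNat ∂μ := by
  have hae : A.connected η βl βe k i =ᵐ[μ] (A.reachable η βe i ∩
      {ω | ∀ j ∈ A.indices (A.interferenceDisk βl i ω) ω, A.tx k j ω = false} : Set Ω) := by
    filter_upwards [A.ae_node_ne_zero hΦl] with ω hω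
    refine propext ⟨fun h => ⟨h.1, fun j hj => ?_⟩, fun h => ⟨h.1, h.2 i ⟨h.1.1, ?_⟩, ?_⟩⟩
    · by_contra hc
      exact hω j hj.1 (h.2.2 j hj (by simpa using hc))
    -- The `i`-th node lies in its own interference disk, so its half-duplex silence is already
    -- among the conditions.
    · exact Metric.mem_closedBall_self (by positivity)
    · intro j hj htx
      rw [h.2 j hj] at htx
      exact absurd htx (by decide)
  have hfin : ∀ ω, (A.indices (A.interferenceDisk βl i ω) ω).Finite := by
    intro ω
    rw [← Set.encard_ne_top_iff, A.encard_indices]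
    exact hΦl.count_ne_top Metric.isBounded_closedBall ω
  have hle : (⨆ j, MeasurableSpace.comap (A.tx k j) inferInstance) ≤
      ⨆ q : ℕ × ℕ, MeasurableSpace.comap (A.tx q.1 q.2) inferInstance :=
    iSup_le fun j => le_iSup (fun q : ℕ × ℕ =>
      MeasurableSpace.comap (A.tx q.1 q.2) inferInstance) (k, j)
  rw [measure_congr hae, measure_inter_forall_mem_eq_false (A.sigmaPositions_le hΦe)
    (A.measurable_tx k) (A.indep_tx.precomp (g := fun j => (k, j)) (Prod.mk_right_injective k))
    (indep_of_indep_of_le_left A.indep_positions hle) (A.measure_tx_eq_false hp k) hfin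
    (A.measurableSet_mem_indices_interferenceDisk βl i) (A.measurableSet_reachable hΦe η βe i)]
  refine lintegral_congr fun ω => ?_
  rw [Set.ncard, A.encard_indices]

theorem lintegral_outDegreeAtOrigin [IsProbabilityMeasure μ] (hp : 0 ≤ p) {lamL lamE : ℝ≥0}
    (hΦl : IsPoissonProcess μ Φl lamL) (hΦe : IsPoissonProcess μ Φe lamE) (η βe : ℝ) {βl : ℝ}
    (hβl : 0 ≤ βl) (k : ℕ) :
    ∫⁻ ω, (outDegreeAtOrigin A η βl βe k ω : ℝ≥0∞) ∂μ = ∑' i, ∫⁻ ω in A.reachable η βe i,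
      ENNReal.ofReal (1 - p) ^ (count Φl (A.interferenceDisk βl i ω) ω).toNat ∂μ := by
  have hm := A.measurableSet_connected hΦe η βl βe k
  simp_rw [A.outDegreeAtOrigin_eq_tsum]
  rw [lintegral_tsum fun i => (measurable_one.indicator (hm i)).aemeasurable]
  refine tsum_congr fun i => ?_
  rw [lintegral_indicator_one (hm i), A.measure_connected hp hΦl hΦe η βe hβl]

end SlottedAloha

end Aloha

/-! ### Square grids and the disks attached to their cells. -/

section Grid

/-- The index of the cell that contains `y` in the square grid of mesh `1 / (n + 1)`. -/
noncomputable def gridIndex (n : ℕ) (y : Plane) : Fin 2 → ℤ := fun i => ⌊((n : ℝ) + 1) * y i⌋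

/-- The corner of a cell in the square grid of mesh `1 / (n + 1)`. -/
noncomputable def gridPoint (n : ℕ) (z : Fin 2 → ℤ) : Plane :=
  WithLp.toLp 2 fun i => (z i : ℝ) / ((n : ℝ) + 1)

/-- An upper bound for the diameter of the cells in the square grid of mesh `1 / (n + 1)`. -/
noncomputable def gridError (n : ℕ) : ℝ := 2 / ((n : ℝ) + 1)

theorem gridError_pos (n : ℕ) : 0 < gridError n := by
  unfold gridError
  positivity

theorem tendsto_gridError : Filter.Tendsto gridError Filter.atTop (nhds 0) := by
  have h := (tendsto_one_div_add_atTop_nhds_zero_nat (𝕜 := ℝ)).const_mul 2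
  rw [mul_zero] at h
  refine h.congr fun n => ?_
  rw [gridError, mul_one_div]

theorem measurable_gridIndex (n : ℕ) : Measurable (gridIndex n) := by
  refine measurable_pi_lambda _ fun i => Int.measurable_floor.comp ?_
  fun_prop

/-- Each coordinate moves by at most `1 / (n + 1)`, so the distance is at most `√2 / (n + 1)`; the
constant `2` is a convenient weakening. -/
theorem dist_gridPoint_le (n : ℕ) (y : Plane) :
    dist y (gridPoint n (gridIndex n y)) ≤ gridError n := by
  have hn : (0 : ℝ) < (n : ℝ) + 1 := by positivity
  have h : ∀ i, dist (y i) ((gridPoint n (gridIndex n y)) i) ≤ 1 / ((n : ℝ) + 1) := by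
    intro i
    have h1 := Int.floor_le (((n : ℝ) + 1) * y i)
    have h2 := (Int.lt_floor_add_one (((n : ℝ) + 1) * y i)).le
    have hp : (gridPoint n (gridIndex n y)) i = (⌊((n : ℝ) + 1) * y i⌋ : ℝ) / ((n : ℝ) + 1) := rfl
    have hs : y i - (⌊((n : ℝ) + 1) * y i⌋ : ℝ) / ((n : ℝ) + 1) =
        (((n : ℝ) + 1) * y i - ⌊((n : ℝ) + 1) * y i⌋) / ((n : ℝ) + 1) := by
      field_simp
    rw [hp, Real.dist_eq, hs, abs_div, abs_of_pos hn, abs_of_nonneg (by linarith)]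
    gcongr
    linarith
  rw [EuclideanSpace.dist_eq, Fin.sum_univ_two]
  refine Real.sqrt_le_iff.2 ⟨(gridError_pos n).le, ?_⟩
  have h0 := pow_le_pow_left₀ dist_nonneg (h 0) 2
  have h1 := pow_le_pow_left₀ dist_nonneg (h 1) 2
  have he : gridError n = 2 * (1 / ((n : ℝ) + 1)) := by rw [gridError, mul_one_div]
  rw [he]
  nlinarith [sq_nonneg (1 / ((n : ℝ) + 1))]

theorem tendsto_gridPoint (y : Plane) :
    Filter.Tendsto (fun n => gridPoint n (gridIndex n y)) Filter.atTop (nhds y) := by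
  rw [tendsto_iff_dist_tendsto_zero]
  refine squeeze_zero (fun _ => dist_nonneg) (fun n => ?_) tendsto_gridError
  rw [dist_comm]
  exact dist_gridPoint_le n y

/-- A disk that contains the interference disks of all points of a cell. -/
noncomputable def cellInterferenceDisk (βl : ℝ) (n : ℕ) (z : Fin 2 → ℤ) : Set Plane :=
  Metric.closedBall (gridPoint n z) (βl * ‖gridPoint n z‖ + (βl + 1) * gridError n)

/-- A disk that contains the secrecy disks of all points of a cell. -/
noncomputable def cellSecrecyDisk (βe : ℝ) (n : ℕ) (z : Fin 2 → ℤ) : Set Plane :=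
  Metric.closedBall 0 (βe * (‖gridPoint n z‖ + gridError n))

theorem norm_le_norm_gridPoint (n : ℕ) (y : Plane) :
    ‖y‖ ≤ ‖gridPoint n (gridIndex n y)‖ + gridError n := by
  have h := dist_gridPoint_le n y
  rw [dist_eq_norm] at h
  linarith [norm_le_norm_add_norm_sub' y (gridPoint n (gridIndex n y))]

theorem norm_gridPoint_le (n : ℕ) (y : Plane) :
    ‖gridPoint n (gridIndex n y)‖ ≤ ‖y‖ + gridError n := by
  have h := dist_gridPoint_le n y
  rw [dist_comm, dist_eq_norm] at h
  linarith [norm_le_norm_add_norm_sub' (gridPoint n (gridIndex n y)) y]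

/-- Moving the centre costs one `gridError`, and the change of radius costs `βl` of them. The
reverse comparison pays the same again, whence the factor `2` there. -/
theorem closedBall_subset_cellInterferenceDisk {βl : ℝ} (hβl : 0 ≤ βl) (n : ℕ) (y : Plane) :
    Metric.closedBall y (βl * ‖y‖) ⊆ cellInterferenceDisk βl n (gridIndex n y) := by
  refine Metric.closedBall_subset_closedBall' ?_
  have h1 := dist_gridPoint_le n y
  have h2 := mul_le_mul_of_nonneg_left (norm_le_norm_gridPoint n y) hβl
  nlinarith

theorem cellInterferenceDisk_subset_closedBall {βl : ℝ} (hβl : 0 ≤ βl) (n : ℕ) (y : Plane) :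
    cellInterferenceDisk βl n (gridIndex n y) ⊆
      Metric.closedBall y (βl * ‖y‖ + 2 * (βl + 1) * gridError n) := by
  refine Metric.closedBall_subset_closedBall' ?_
  have h1 := dist_gridPoint_le n y
  rw [dist_comm] at h1
  have h2 := mul_le_mul_of_nonneg_left (norm_gridPoint_le n y) hβl
  nlinarith

theorem closedBall_subset_cellSecrecyDisk {βe : ℝ} (hβe : 0 ≤ βe) (n : ℕ) (y : Plane) :
    Metric.closedBall 0 (βe * ‖y‖) ⊆ cellSecrecyDisk βe n (gridIndex n y) :=
  Metric.closedBall_subset_closedBall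
    (mul_le_mul_of_nonneg_left (norm_le_norm_gridPoint n y) hβe)

theorem cellSecrecyDisk_subset_closedBall {βe : ℝ} (hβe : 0 ≤ βe) (n : ℕ) (y : Plane) :
    cellSecrecyDisk βe n (gridIndex n y) ⊆
      Metric.closedBall 0 (βe * ‖y‖ + 2 * βe * gridError n) := by
  refine Metric.closedBall_subset_closedBall ?_
  have h2 := mul_le_mul_of_nonneg_left (norm_gridPoint_le n y) hβe
  nlinarith

/-- The part of a cell within distance `η` of the origin. -/
def cell (η : ℝ) (n : ℕ) (z : Fin 2 → ℤ) : Set Plane :=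
  Metric.ball 0 η ∩ gridIndex n ⁻¹' {z}

theorem measurableSet_cell (η : ℝ) (n : ℕ) (z : Fin 2 → ℤ) : MeasurableSet (cell η n z) :=
  measurableSet_ball.inter (measurable_gridIndex n (measurableSet_singleton z))

theorem iUnion_cell (η : ℝ) (n : ℕ) : ⋃ z, cell η n z = Metric.ball 0 η := by
  ext y
  simp [cell]

theorem pairwise_disjoint_cell (η : ℝ) (n : ℕ) :
    Pairwise (Function.onFun Disjoint (cell η n)) := by
  intro z w hzw
  refine Set.disjoint_left.2 fun y hy hy' => hzw ?_
  exact (show gridIndex n y = z from hy.2).symm.trans hy'.2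

/-- Every point is in its own interference disk. This is the inclusion `C ⊆ D` required by
`lintegral_count_mul_pow_count_of_subset`. -/
theorem cell_subset_cellInterferenceDisk {βl : ℝ} (hβl : 0 ≤ βl) (η : ℝ) (n : ℕ)
    (z : Fin 2 → ℤ) : cell η n z ⊆ cellInterferenceDisk βl n z := by
  intro y hy
  rw [← show gridIndex n y = z from hy.2]
  exact closedBall_subset_cellInterferenceDisk hβl n y
    (Metric.mem_closedBall_self (by positivity))

theorem volume_real_closedBall (x : Plane) {r : ℝ} (hr : 0 ≤ r) :
    volume.real (Metric.closedBall x r) = r ^ 2 * Real.pi := by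
  simp [Measure.real, EuclideanSpace.volume_closedBall_fin_two, hr, Real.pi_pos.le]

theorem tendsto_volume_real_cellInterferenceDisk {βl : ℝ} (hβl : 0 ≤ βl) (y : Plane) :
    Filter.Tendsto (fun n => volume.real (cellInterferenceDisk βl n (gridIndex n y)))
      Filter.atTop (nhds ((βl * ‖y‖) ^ 2 * Real.pi)) := by
  have h : ∀ n, volume.real (cellInterferenceDisk βl n (gridIndex n y)) =
      (βl * ‖gridPoint n (gridIndex n y)‖ + (βl + 1) * gridError n) ^ 2 * Real.pi := fun n =>
    volume_real_closedBall _ (by have := gridError_pos n; positivity)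
  simp_rw [h]
  have := (((tendsto_gridPoint y).norm.const_mul βl).add
    (tendsto_gridError.const_mul (βl + 1))).pow 2 |>.mul_const Real.pi
  simpa using this

theorem tendsto_volume_real_cellSecrecyDisk {βe : ℝ} (hβe : 0 ≤ βe) (y : Plane) :
    Filter.Tendsto (fun n => volume.real (cellSecrecyDisk βe n (gridIndex n y)))
      Filter.atTop (nhds ((βe * ‖y‖) ^ 2 * Real.pi)) := by
  have h : ∀ n, volume.real (cellSecrecyDisk βe n (gridIndex n y)) =
      (βe * (‖gridPoint n (gridIndex n y)‖ + gridError n)) ^ 2 * Real.pi := fun n =>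
    volume_real_closedBall _ (by have := gridError_pos n; positivity)
  simp_rw [h]
  have := ((((tendsto_gridPoint y).norm.add tendsto_gridError).const_mul βe).pow 2).mul_const
    Real.pi
  simpa using this

end Grid

/-! ### Grid approximation and passage to the limit. -/

section Approximation

variable {Ω : Type*} [MeasurableSpace Ω] {μ : Measure Ω} {Φl Φe : Ω → Set Plane} {p : ℝ}

/-- The conditional probability, given the positions, that a receiver in the cell `z` can be reached,
with the interference and the secrecy disk replaced by those of the cell. -/
noncomputable def cellWeight (Φl Φe : Ω → Set Plane) (q : ℝ≥0∞) (βl βe : ℝ) (n : ℕ)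
    (z : Fin 2 → ℤ) (ω : Ω) : ℝ≥0∞ :=
  q ^ (count Φl (cellInterferenceDisk βl n z) ω).toNat *
    {ω | count Φe (cellSecrecyDisk βe n z) ω = 0}.indicator 1 ω

theorem measurable_cellWeight {lamL lamE : ℝ≥0} (hΦl : IsPoissonProcess μ Φl lamL)
    (hΦe : IsPoissonProcess μ Φe lamE) (q : ℝ≥0∞) (βl βe : ℝ) (n : ℕ) (z : Fin 2 → ℤ) :
    Measurable (cellWeight Φl Φe q βl βe n z) := by
  refine Measurable.mul ?_ (measurable_one.indicator ?_)
  · exact (Measurable.of_discrete (f := fun m : ℕ∞ => q ^ m.toNat)).comp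
      (hΦl.measurable_count _ Metric.isClosed_closedBall.measurableSet)
  · exact hΦe.measurable_count _ Metric.isClosed_closedBall.measurableSet
      (measurableSet_singleton 0)

theorem lintegral_count_cell_mul_cellWeight {lamL lamE : ℝ≥0}
    (hΦl : IsPoissonProcess μ Φl lamL) (hΦe : IsPoissonProcess μ Φe lamE)
    (hindep : Indep (sigmaPoints Φl) (sigmaPoints Φe) μ) {q : ℝ} (hq : 0 ≤ q) (η : ℝ) {βl : ℝ}
    (hβl : 0 ≤ βl) (βe : ℝ) (n : ℕ) (z : Fin 2 → ℤ) :
    ∫⁻ ω, (count Φl (cell η n z) ω : ℝ≥0∞) *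
        cellWeight Φl Φe (ENNReal.ofReal q) βl βe n z ω ∂μ =
      ENNReal.ofReal (lamL * q * Real.exp (-(lamL * volume.real (cellInterferenceDisk βl n z) *
          (1 - q) + lamE * volume.real (cellSecrecyDisk βe n z)))) * volume (cell η n z) := by
  have hC := measurableSet_cell η n z
  have hD : MeasurableSet (cellInterferenceDisk βl n z) :=
    Metric.isClosed_closedBall.measurableSet
  have hK : MeasurableSet (cellSecrecyDisk βe n z) := Metric.isClosed_closedBall.measurableSet
  have hCfin : volume (cell η n z) ≠ ∞ :=
    (Metric.isBounded_ball.subset Set.inter_subset_left).measure_lt_top.ne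
  have hf : Measurable[sigmaPoints Φl] fun ω => (count Φl (cell η n z) ω : ℝ≥0∞) *
      ENNReal.ofReal q ^ (count Φl (cellInterferenceDisk βl n z) ω).toNat :=
    Measurable.mul
      ((Measurable.of_discrete (f := ENat.toENNReal)).comp (measurable_count_sigmaPoints hC))
      ((Measurable.of_discrete (f := fun m : ℕ∞ => ENNReal.ofReal q ^ m.toNat)).comp
        (measurable_count_sigmaPoints hD))
  have hset : MeasurableSet[sigmaPoints Φe] {ω | count Φe (cellSecrecyDisk βe n z) ω = 0} :=
    measurable_count_sigmaPoints hK (measurableSet_singleton 0)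
  have hg : Measurable[sigmaPoints Φe]
      ({ω | count Φe (cellSecrecyDisk βe n z) ω = 0}.indicator (1 : Ω → ℝ≥0∞)) :=
    Measurable.indicator (@measurable_one _ _ _ (sigmaPoints Φe) _) hset
  simp_rw [cellWeight, ← mul_assoc]
  rw [lintegral_mul_eq_lintegral_mul_lintegral_of_independent_measurableSpace hΦl.sigmaPoints_le
    hΦe.sigmaPoints_le hindep hf hg,
    hΦl.lintegral_count_mul_pow_count_of_subset hC hD
      (cell_subset_cellInterferenceDisk hβl η n z) Metric.isBounded_closedBall hq,
    lintegral_indicator_one (hΦe.sigmaPoints_le _ hset),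
    hΦe.measure_count_eq_zero hK Metric.isBounded_closedBall.measure_lt_top.ne,
    ← ENNReal.ofReal_toReal hCfin, ← ENNReal.ofReal_mul (by positivity),
    ← ENNReal.ofReal_mul (by positivity), neg_add, Real.exp_add]
  congr 1
  rw [measureReal_def]
  ring

namespace SlottedAloha

variable (A : SlottedAloha μ Φl Φe p)

/-- Each node within range lies in exactly one cell, and the weight depends on the node only through
that cell. -/
theorem tsum_indicator_cellWeight (q : ℝ≥0∞) (η βl βe : ℝ) (n : ℕ) (ω : Ω) :
    ∑' i, (A.indices (Metric.ball 0 η) ω).indicator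
        (fun i => cellWeight Φl Φe q βl βe n (gridIndex n (A.node i ω)) ω) i =
      ∑' z, (count Φl (cell η n z) ω : ℝ≥0∞) * cellWeight Φl Φe q βl βe n z ω := by
  simp_rw [A.count_eq_tsum, ← ENNReal.tsum_mul_right]
  rw [ENNReal.tsum_comm]
  refine tsum_congr fun i => ?_
  rw [tsum_eq_single (gridIndex n (A.node i ω))]
  · by_cases hi : i ∈ A.indices (Metric.ball 0 η) ω
    · have hc : i ∈ A.indices (cell η n (gridIndex n (A.node i ω))) ω := ⟨hi.1, hi.2, rfl⟩
      rw [Set.indicator_of_mem hi, Set.indicator_of_mem hc, Pi.one_apply, one_mul]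
    · rw [Set.indicator_of_notMem hi, Set.indicator_of_notMem, zero_mul]
      exact fun h => hi ⟨h.1, h.2.1⟩
  · intro z hz
    rw [Set.indicator_of_notMem, zero_mul]
    exact fun h => hz (show gridIndex n (A.node i ω) = z from h.2.2).symm

/-- The contribution of the `i`-th node to the approximate conditional out-degree. -/
noncomputable def approxTerm (q : ℝ≥0∞) (η βl βe : ℝ) (n : ℕ) (x : Ω × ℕ) : ℝ≥0∞ :=
  (A.indices (Metric.ball 0 η) x.1).indicator
    (fun i => cellWeight Φl Φe q βl βe n (gridIndex n (A.node i x.1)) x.1) x.2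

/-- The contribution of the `i`-th node to the conditional expectation of the out-degree, given the
positions. -/
noncomputable def limitTerm (q : ℝ≥0∞) (η βl βe : ℝ) (x : Ω × ℕ) : ℝ≥0∞ :=
  (A.reachable η βe x.2).indicator
    (fun ω => q ^ (count Φl (A.interferenceDisk βl x.2 ω) ω).toNat) x.1

theorem measurableSet_mem_indices {B : Set Plane} (hB : MeasurableSet B) (i : ℕ) :
    MeasurableSet {ω | i ∈ A.indices B ω} :=
  (A.measurable_num (t := {n | (i : ℕ∞) < n}) .of_discrete).inter (A.measurable_node i hB)

theorem measurable_approxTerm {lamL lamE : ℝ≥0} (hΦl : IsPoissonProcess μ Φl lamL)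
    (hΦe : IsPoissonProcess μ Φe lamE) (q : ℝ≥0∞) (η βl βe : ℝ) (n : ℕ) :
    Measurable (A.approxTerm q η βl βe n) := by
  refine measurable_from_prod_countable_left fun i => ?_
  have hw : Measurable fun x : (Fin 2 → ℤ) × Ω => cellWeight Φl Φe q βl βe n x.1 x.2 :=
    measurable_from_prod_countable_right fun z => measurable_cellWeight hΦl hΦe q βl βe n z
  have h := (hw.comp (((measurable_gridIndex n).comp (A.measurable_node i)).prodMk
    measurable_id)).indicator (A.measurableSet_mem_indices measurableSet_ball i
      (B := Metric.ball 0 η))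
  exact h

/-- For fixed positions the sequence is eventually constant: the cell disks shrink to closed disks,
and a locally finite set does not see a small enlargement of those. -/
theorem tendsto_approxTerm {lamL lamE : ℝ≥0} (hΦl : IsPoissonProcess μ Φl lamL)
    (hΦe : IsPoissonProcess μ Φe lamE) (q : ℝ≥0∞) (η : ℝ) {βl βe : ℝ} (hβl : 0 ≤ βl)
    (hβe : 0 ≤ βe) (x : Ω × ℕ) :
    Filter.Tendsto (fun n => A.approxTerm q η βl βe n x) Filter.atTop
      (nhds (A.limitTerm q η βl βe x)) := by
  obtain ⟨ω, i⟩ := x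
  refine tendsto_const_nhds.congr' ?_
  have h1 := eventually_count_eq_count_closedBall (hΦl.locallyFinite ω)
    (by simpa using tendsto_gridError.const_mul (2 * (βl + 1)))
    (fun n => closedBall_subset_cellInterferenceDisk hβl n (A.node i ω))
    (fun n => cellInterferenceDisk_subset_closedBall hβl n (A.node i ω))
  have h2 := eventually_count_eq_count_closedBall (hΦe.locallyFinite ω)
    (by simpa using tendsto_gridError.const_mul (2 * βe))
    (fun n => closedBall_subset_cellSecrecyDisk hβe n (A.node i ω))
    (fun n => cellSecrecyDisk_subset_closedBall hβe n (A.node i ω))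
  filter_upwards [h1, h2] with n hn1 hn2
  by_cases hi : i ∈ A.indices (Metric.ball 0 η) ω
  · simp only [approxTerm, Set.indicator_of_mem hi, cellWeight, hn1, limitTerm]
    have hnorm : ‖A.node i ω‖ < η := by simpa using hi.2
    by_cases hc : count Φe (Metric.closedBall 0 (βe * ‖A.node i ω‖)) ω = 0
    · rw [Set.indicator_of_mem (show ω ∈ A.reachable η βe i from ⟨hi.1, hnorm, hc⟩),
        Set.indicator_of_mem (show ω ∈ {ω' | count Φe
          (cellSecrecyDisk βe n (gridIndex n (A.node i ω))) ω' = 0} from hn2.trans hc), Pi.one_apply, mul_one]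
      rfl
    · rw [Set.indicator_of_notMem (show ω ∉ A.reachable η βe i from fun h => hc h.2.2),
        Set.indicator_of_notMem (show ω ∉ {ω' | count Φe
          (cellSecrecyDisk βe n (gridIndex n (A.node i ω))) ω' = 0} from
            fun h => hc (hn2.symm.trans h)), mul_zero]
  · simp only [approxTerm, Set.indicator_of_notMem hi, limitTerm]
    rw [Set.indicator_of_notMem]
    exact fun h => hi ⟨h.1, by simpa using h.2.1⟩

/-- The dominating function: summed over nodes it is the number of nodes within range, which has
finite mean. -/
theorem approxTerm_le {q : ℝ≥0∞} (hq : q ≤ 1) (η βl βe : ℝ) (n : ℕ) (x : Ω × ℕ) :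
    A.approxTerm q η βl βe n x ≤ (A.indices (Metric.ball 0 η) x.1).indicator 1 x.2 := by
  refine Set.indicator_le_indicator ?_
  exact mul_le_one' (pow_le_one' hq _) (Set.indicator_le_self' (by simp) _)

theorem lintegral_approxTerm [IsProbabilityMeasure μ] {lamL lamE : ℝ≥0}
    (hΦl : IsPoissonProcess μ Φl lamL) (hΦe : IsPoissonProcess μ Φe lamE)
    (hindep : Indep (sigmaPoints Φl) (sigmaPoints Φe) μ) {q : ℝ} (hq : 0 ≤ q) (η : ℝ) {βl : ℝ}
    (hβl : 0 ≤ βl) (βe : ℝ) (n : ℕ) :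
    ∫⁻ x, A.approxTerm (ENNReal.ofReal q) η βl βe n x ∂(μ.prod Measure.count) =
      ∫⁻ y in Metric.ball (0 : Plane) η, ENNReal.ofReal (lamL * q * Real.exp (-(lamL *
        volume.real (cellInterferenceDisk βl n (gridIndex n y)) * (1 - q) +
        lamE * volume.real (cellSecrecyDisk βe n (gridIndex n y))))) := by
  rw [lintegral_prod _ (A.measurable_approxTerm hΦl hΦe _ η βl βe n).aemeasurable]
  simp_rw [lintegral_count, approxTerm, A.tsum_indicator_cellWeight]
  rw [lintegral_tsum (f := fun z ω => (count Φl (cell η n z) ω : ℝ≥0∞) *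
    cellWeight Φl Φe (ENNReal.ofReal q) βl βe n z ω) fun z => (Measurable.mul
    ((Measurable.of_discrete (f := ENat.toENNReal)).comp
      (hΦl.measurable_count _ (measurableSet_cell η n z)))
    (measurable_cellWeight hΦl hΦe _ βl βe n z)).aemeasurable]
  rw [← iUnion_cell η n, lintegral_iUnion (measurableSet_cell η n) (pairwise_disjoint_cell η n)]
  refine tsum_congr fun z => ?_
  rw [lintegral_count_cell_mul_cellWeight hΦl hΦe hindep hq η hβl,
    ← setLIntegral_const]
  refine setLIntegral_congr_fun (measurableSet_cell η n z) fun y hy => ?_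
  simp only [show gridIndex n y = z from hy.2]

/-- The integrals of `approxTerm` have two limits, which must agree. Treating the sum over nodes as
an integral on `Ω × ℕ` lets one dominated convergence handle sum and expectation together. -/
theorem lintegral_limitTerm [IsProbabilityMeasure μ] {lamL lamE : ℝ≥0}
    (hΦl : IsPoissonProcess μ Φl lamL) (hΦe : IsPoissonProcess μ Φe lamE)
    (hindep : Indep (sigmaPoints Φl) (sigmaPoints Φe) μ) {q : ℝ} (hq : 0 ≤ q) (hq1 : q ≤ 1)
    (η : ℝ) {βl βe : ℝ} (hβl : 0 ≤ βl) (hβe : 0 ≤ βe) :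
    ∫⁻ x, A.limitTerm (ENNReal.ofReal q) η βl βe x ∂(μ.prod Measure.count) =
      ∫⁻ y in Metric.ball (0 : Plane) η, ENNReal.ofReal (lamL * q * Real.exp (-(lamL *
        ((βl * ‖y‖) ^ 2 * Real.pi) * (1 - q) + lamE * ((βe * ‖y‖) ^ 2 * Real.pi)))) := by
  have hind : Measurable fun x : Ω × ℕ =>
      (A.indices (Metric.ball 0 η) x.1).indicator (1 : ℕ → ℝ≥0∞) x.2 := by
    refine measurable_from_prod_countable_left fun i => ?_
    exact measurable_one.indicator (A.measurableSet_mem_indices measurableSet_ball i)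
  have hbound : ∫⁻ x, (A.indices (Metric.ball 0 η) x.1).indicator (1 : ℕ → ℝ≥0∞) x.2
      ∂(μ.prod Measure.count) ≠ ∞ := by
    rw [lintegral_prod _ hind.aemeasurable]
    simp_rw [lintegral_count, ← A.count_eq_tsum]
    rw [hΦl.lintegral_count_eq measurableSet_ball Metric.isBounded_ball.measure_lt_top.ne]
    exact ENNReal.ofReal_ne_top
  have hl := tendsto_lintegral_of_dominated_convergence _
    (fun n => A.measurable_approxTerm hΦl hΦe (ENNReal.ofReal q) η βl βe n)
    (fun n => ae_of_all (μ.prod Measure.count)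
      (A.approxTerm_le (ENNReal.ofReal_le_one.2 hq1) η βl βe n)) hbound
    (ae_of_all _ (A.tendsto_approxTerm hΦl hΦe (ENNReal.ofReal q) η hβl hβe))
  simp_rw [A.lintegral_approxTerm hΦl hΦe hindep hq η hβl βe] at hl
  refine tendsto_nhds_unique hl ?_
  -- The second limit is taken in the plane: the areas of the cell disks converge, and the integrand
  -- is bounded by a constant on a disk of finite area.
  refine tendsto_lintegral_of_dominated_convergence (fun _ => ENNReal.ofReal (lamL * q))
    (fun n => ?_) (fun n => ae_of_all _ fun y => ?_) ?_ (ae_of_all _ fun y => ?_)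
  · exact (Measurable.of_discrete (f := fun z : Fin 2 → ℤ => ENNReal.ofReal (lamL * q *
      Real.exp (-(lamL * volume.real (cellInterferenceDisk βl n z) * (1 - q) +
        lamE * volume.real (cellSecrecyDisk βe n z)))))).comp (measurable_gridIndex n)
  · refine ENNReal.ofReal_le_ofReal (mul_le_of_le_one_right (by positivity) ?_)
    refine Real.exp_le_one_iff.2 (neg_nonpos.2 ?_)
    have : 0 ≤ 1 - q := by linarith
    positivity
  · rw [setLIntegral_const]
    exact ENNReal.mul_ne_top ENNReal.ofReal_ne_top Metric.isBounded_ball.measure_lt_top.ne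
  · refine ENNReal.tendsto_ofReal (Filter.Tendsto.const_mul _
      ((Real.continuous_exp.tendsto _).comp (Filter.Tendsto.neg ?_)))
    exact (((tendsto_volume_real_cellInterferenceDisk hβl y).const_mul _).mul_const _).add
      ((tendsto_volume_real_cellSecrecyDisk hβe y).const_mul _)

/-- The count in a disk with random centre and radius is handled as a pointwise limit of the
measurable grid approximations. -/
theorem measurable_limitTerm {lamL lamE : ℝ≥0} (hΦl : IsPoissonProcess μ Φl lamL)
    (hΦe : IsPoissonProcess μ Φe lamE) (q : ℝ≥0∞) (η : ℝ) {βl βe : ℝ} (hβl : 0 ≤ βl)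
    (hβe : 0 ≤ βe) : Measurable (A.limitTerm q η βl βe) :=
  measurable_of_tendsto_metrizable (A.measurable_approxTerm hΦl hΦe q η βl βe)
    (tendsto_pi_nhds.2 (A.tendsto_approxTerm hΦl hΦe q η hβl hβe))

theorem lintegral_outDegreeAtOrigin_eq_lintegral_limitTerm [IsProbabilityMeasure μ] (hp : 0 ≤ p)
    {lamL lamE : ℝ≥0} (hΦl : IsPoissonProcess μ Φl lamL) (hΦe : IsPoissonProcess μ Φe lamE)
    (η : ℝ) {βl βe : ℝ} (hβl : 0 ≤ βl) (hβe : 0 ≤ βe) (k : ℕ) :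
    ∫⁻ ω, (outDegreeAtOrigin A η βl βe k ω : ℝ≥0∞) ∂μ =
      ∫⁻ x, A.limitTerm (ENNReal.ofReal (1 - p)) η βl βe x ∂(μ.prod Measure.count) := by
  have hm := A.measurable_limitTerm hΦl hΦe (ENNReal.ofReal (1 - p)) η hβl hβe
  rw [A.lintegral_outDegreeAtOrigin hp hΦl hΦe η βe hβl, lintegral_prod _ hm.aemeasurable]
  simp_rw [lintegral_count]
  rw [lintegral_tsum (f := fun i ω => A.limitTerm (ENNReal.ofReal (1 - p)) η βl βe (ω, i))
    fun i => (hm.comp measurable_prodMk_right).aemeasurable]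
  refine tsum_congr fun i => ?_
  rw [← lintegral_indicator (A.sigmaPositions_le hΦe _ (A.measurableSet_reachable hΦe η βe i))]
  rfl

end SlottedAloha

end Approximation

end SecureGraph

open SecureGraph in
theorem mainTheorem1 {Ω : Type*} [MeasurableSpace Ω] (μ : Measure Ω) [IsProbabilityMeasure μ]
    (Φl Φe : Ω → Set Plane) (lamL lamE : ℝ≥0) (p : ℝ) (hp0 : 0 ≤ p) (hp1 : p ≤ 1)
    (hΦl : IsPoissonProcess μ Φl lamL) (hΦe : IsPoissonProcess μ Φe lamE)
    (hindep : Indep (sigmaPoints Φl) (sigmaPoints Φe) μ)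
    (A : SlottedAloha μ Φl Φe p)
    (η βl βe : ℝ) (hη : 0 < η) (hβl : 0 < βl) (hβe : 0 < βe)
    (hden : (lamL : ℝ) * p * βl ^ 2 + (lamE : ℝ) * βe ^ 2 ≠ 0) (k : ℕ) :
    Measurable (outDegreeAtOrigin A η βl βe k) ∧
    ∫⁻ ω, (outDegreeAtOrigin A η βl βe k ω : ℝ≥0∞) ∂μ =
      ENNReal.ofReal
        ((lamL : ℝ) * (1 - p) *
            (1 - Real.exp (-((lamL * p * βl ^ 2 + lamE * βe ^ 2) * Real.pi * η ^ 2))) /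
          (lamL * p * βl ^ 2 + lamE * βe ^ 2)) := by
  refine ⟨A.measurable_outDegreeAtOrigin hΦe η βl βe k, ?_⟩
  have hq : 0 ≤ 1 - p := by linarith
  rw [A.lintegral_outDegreeAtOrigin_eq_lintegral_limitTerm hp0 hΦl hΦe η hβl.le hβe.le,
    A.lintegral_limitTerm hΦl hΦe hindep hq (by linarith) η hβl.le hβe.le, mul_div_assoc,
    ENNReal.ofReal_mul (by positivity), ← lintegral_ball_exp_neg_mul_norm_sq hden hη,
    ← lintegral_const_mul' _ _ ENNReal.ofReal_ne_top]
  refine lintegral_congr fun y => ?_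
  rw [← ENNReal.ofReal_mul (by positivity)]
  -- What remains is the identity of exponents, where `1 - (1 - p) = p` produces the coefficient
  -- `lamL * p * βl ^ 2 + lamE * βe ^ 2`.
  congr 3
  ring
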